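/- Let $\alpha,\beta>-1$ be real and $n\ge 0$ an integer. Write $(a)_m=a(a+1)\cdots(a+m-1)$, let $P_m^{(\alpha,\beta)}(x)=\frac{(\alpha+1)_m}{m!}\,{}_2F_1\!\left(-m,\,m+\alpha+\beta+1;\,\alpha+1;\,\tfrac{1-x}{2}\right)$ be the Jacobi polynomials, and let $G$ be the Barnes $G$-function (the entire function with $G(1)=1$, $G(z+1)=\Gamma(z)G(z)$), that is, $$G(z+1)=(2\pi)^{z/2}e^{-[z(z+1)+\gamma z^2]/2}\prod_{k=1}^{\infty}\Big(1+\frac zk\Big)^k e^{-z+z^2/(2k)},$$ where $\gamma$ is Euler's constant. Consider the matrix $$H_n=\Big({}_2F_1(-i-j,\ \beta+1;\ \alpha+\beta+2;\ 2)\Big)_{0\le i,j\le n}.$$ Its entries are the signed normalized moments of the Jacobi weight: with $\mu_m=\int_{-1}^1x^m(1-x)^\alpha(1+x)^\beta\,dx$ one has $\mu_0>0$ and $(H_n)_{ij}=(-1)^{i+j}\mu_{i+j}/\mu_0$. The matrix $H_n$ is invertible. If $\alpha+\beta\neq-1$, then its determinant is $$\det H_n=\left(\frac{\Gamma(\alpha+\beta+2)\,2^{-(2\alpha+2\beta+n+1)}\,\pi}{\Gamma(\alpha+1)\Gamma(\beta+1)}\right)^{n+1}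 \frac{G(n+2)\,G\!\left(\frac{\alpha+\beta+1}{2}\right)^2G\!\left(\frac{\alpha+\beta+2}{2}\right)^2}{G\!\left(\frac{\alpha+\beta+3}{2}+n\right)^2G\!\left(\frac{\alpha+\beta+4}{2}+n\right)^2} \cdot\frac{G(\alpha+\beta+n+2)\,G(\alpha+n+2)\,G(\beta+n+2)}{\left(\frac{\alpha+\beta+1}{2}\right)_{n+1}G(\alpha+\beta+1)\,G(\alpha+1)\,G(\beta+1)},$$ and the entries of $H_n^{-1}$ are, for $0\le i,j\le n$, $$(H_n^{-1})_{ij}=\sum_{k=\max(i,j)}^{n}\frac{k!\,(2k+\alpha+\beta+1)\,(\alpha+\beta+1)_k}{(\alpha+\beta+1)\,(-2)^{i+j}\,i!\,j!\,(\alpha+1)_k(\beta+1)_k}\, \Big\{(k+\alpha+\beta+1)_i\,P_{k-i}^{(\alpha+i,\beta+i)}(0)\Big\}\Big\{(k+\alpha+\beta+1)_j\,P_{k-j}^{(\alpha+j,\beta+j)}(0)\Big\}.$$ If $\alpha+\beta=-1$, the same formulas hold with each right-hand side replaced by its limit as $(\alpha',\beta')\to(\alpha,\beta)$ through real pairs with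 $\alpha'+\beta'\ne-1$. -/

import Mathlib

open Filter Topology

noncomputable section

/-- The Barnes `G`-function, the entire function with `G 1 = 1` and `G (z + 1) = Γ z * G z`,
through its Weierstrass product: with `w = z - 1`,
`G z = (2π)^(w/2) * exp (-(w (w + 1) + γ w²) / 2) * ∏_{k ≥ 1} (1 + w/k)^k * exp (-w + w²/(2k))`. -/
def barnesG (z : ℂ) : ℂ :=
  (2 * (Real.pi : ℂ)) ^ ((z - 1) / 2) *
    Complex.exp
      (-((z - 1) * ((z - 1) + 1) + (Real.eulerMascheroniConstant : ℂ) * (z - 1) ^ 2) / 2) *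
    ∏' m : ℕ, ((1 + (z - 1) / ((m : ℂ) + 1)) ^ (m + 1) *
      Complex.exp (-(z - 1) + (z - 1) ^ 2 / (2 * ((m : ℂ) + 1))))

/-- The shifted factorial `(a)_n = a (a + 1) ⋯ (a + n - 1)`. -/
def shiftedFactorial (a : ℝ) (n : ℕ) : ℝ := (ascPochhammer ℝ n).eval a

/-- The Jacobi polynomial
`P_n^{(α, β)}(x) = (α + 1)_n / n! * ₂F₁(-n, n + α + β + 1; α + 1; (1 - x) / 2)`. -/
def jacobiP (n : ℕ) (α β x : ℝ) : ℝ :=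
  shiftedFactorial (α + 1) n / (n.factorial : ℝ) *
    ordinaryHypergeometric (-(n : ℝ)) ((n : ℝ) + α + β + 1) (α + 1) ((1 - x) / 2)

/-- The moments of the Jacobi weight `(1 - x)^α (1 + x)^β` on `[-1, 1]`. -/
def jacobiMoment (α β : ℝ) (m : ℕ) : ℝ :=
  ∫ x in (-1 : ℝ)..1, x ^ m * ((1 - x) ^ α * (1 + x) ^ β)

/-- The Hankel matrix with entries `₂F₁(-i-j, β + 1; α + β + 2; 2)`, `0 ≤ i, j ≤ n`. -/
def jacobiHankel (α β : ℝ) (n : ℕ) : Matrix (Fin (n + 1)) (Fin (n + 1)) ℝ :=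
  Matrix.of fun i j =>
    ordinaryHypergeometric (-((i : ℕ) : ℝ) - ((j : ℕ) : ℝ)) (β + 1) (α + β + 2) (2 : ℝ)

/-- The closed form of the determinant of `jacobiHankel α β n`. -/
def jacobiHankelDet (α β : ℝ) (n : ℕ) : ℂ :=
  (((Real.Gamma (α + β + 2) * (2 : ℝ) ^ (-(2 * α + 2 * β + (n : ℝ) + 1)) * Real.pi /
      (Real.Gamma (α + 1) * Real.Gamma (β + 1))) ^ (n + 1) : ℝ) : ℂ) *
    ((barnesG ((n : ℂ) + 2) * barnesG (((α : ℂ) + β + 1) / 2) ^ 2 *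
        barnesG (((α : ℂ) + β + 2) / 2) ^ 2) /
      (barnesG (((α : ℂ) + β + 3) / 2 + n) ^ 2 * barnesG (((α : ℂ) + β + 4) / 2 + n) ^ 2)) *
    ((barnesG ((α : ℂ) + β + n + 2) * barnesG ((α : ℂ) + n + 2) * barnesG ((β : ℂ) + n + 2)) /
      ((shiftedFactorial ((α + β + 1) / 2) (n + 1) : ℂ) *
        barnesG ((α : ℂ) + β + 1) * barnesG ((α : ℂ) + 1) * barnesG ((β : ℂ) + 1)))

/-- The closed form of the `(i, j)` entry of the inverse of `jacobiHankel α β n`. -/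
def jacobiHankelInv (α β : ℝ) (n i j : ℕ) : ℝ :=
  ∑ k ∈ Finset.Icc (max i j) n,
    (k.factorial : ℝ) * (2 * (k : ℝ) + α + β + 1) * shiftedFactorial (α + β + 1) k /
      ((α + β + 1) * (-2 : ℝ) ^ (i + j) * (i.factorial : ℝ) * (j.factorial : ℝ) *
        shiftedFactorial (α + 1) k * shiftedFactorial (β + 1) k) *
    ((shiftedFactorial ((k : ℝ) + α + β + 1) i *
        jacobiP (k - i) (α + (i : ℝ)) (β + (i : ℝ)) 0) *
      (shiftedFactorial ((k : ℝ) + α + β + 1) j *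
        jacobiP (k - j) (α + (j : ℝ)) (β + (j : ℝ)) 0))

end

/-!
Both closed forms come from the orthogonality of the Jacobi polynomials. Expanding `x` around `-1`
turns the Beta integral into `(-1)^m μ_m / μ_0 = ₂F₁(-m, β + 1; α + β + 2; 2)`, so the Hankel matrix
`H` is the Gram matrix of the powers of `-x` for the normalized Jacobi weight. This weight is
carried algebraically: in the variable `u = (1 + x) / 2` it is the functional `jacobiFunctional`
with moments `(β + 1)_k / (α + β + 2)_k`, for which
`L ((1 - u)^m u^j) = (α + 1)_m (β + 1)_j / (α + β + 2)_{m+j}`. The hypergeometric sum for `P_k`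
tested against `u^j` is then a Chu–Vandermonde sum with value a multiple of `(j + 1 - k)_k`; it
vanishes for `j < k` and gives the squared norm `d_k` of `P_k` for `j = k`
(`jacobiFunctional_jacobiPoly_mul_jacobiPoly`).

Let `A` be the lower triangular matrix whose row `k` holds the coefficients of `P_k` in powers of
`-x`; by Taylor's formula at `0` they are values at `0` of Jacobi polynomials with shifted
parameters. Orthogonality reads `A H Aᵀ = diag(d_k)` (`jacobiTaylorMatrix_mul_jacobiHankel_mul`),
with `d_k > 0`. Hence `H` is invertible, `H⁻¹ = Aᵀ diag(d_k)⁻¹ A` is the asserted sum, and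
`det H` is the product of the numbers `d_k / A_kk²`.

To recognize this product in the formula with Barnes `G`-functions, the two sides are compared for
consecutive `n` (`jacobiHankelDet_succ`): by `G (z + 1) = Γ z * G z` the ratio of the right-hand
sides consists of `Γ`-values, which Legendre's duplication formula reduces to `d_k / A_kk²`. The
functional equation (`barnesG_add_one`) is read off the Weierstrass product: the quotient of the
partial products at `w + 1` and `w` telescopes, and its limit follows from Euler's limit for `Γ`,
Stirling's formula and the definition of Euler's constant.

On the line `α + β = -1` nothing has to be computed: off the line the closed forms equal
`det H` and the entries of `H⁻¹`, and these are continuous in `(α, β)` across it.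
-/

noncomputable section

/-! ### Shifted factorials and terminating hypergeometric sums -/

@[simp] lemma shiftedFactorial_zero (a : ℝ) : shiftedFactorial a 0 = 1 := by
  simp [shiftedFactorial]

lemma shiftedFactorial_succ (a : ℝ) (n : ℕ) :
    shiftedFactorial a (n + 1) = shiftedFactorial a n * (a + n) := by
  simp [shiftedFactorial, ascPochhammer_succ_eval]

lemma shiftedFactorial_add (a : ℝ) (m n : ℕ) :
    shiftedFactorial a (m + n) = shiftedFactorial a m * shiftedFactorial (a + m) n := by
  induction n with
  | zero => simp
  | succ n ih =>
    rw [← add_assoc, shiftedFactorial_succ, shiftedFactorial_succ, ih]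
    push_cast
    ring

lemma shiftedFactorial_succ_left (a : ℝ) (n : ℕ) :
    shiftedFactorial a (n + 1) = a * shiftedFactorial (a + 1) n := by
  rw [add_comm n 1, shiftedFactorial_add, shiftedFactorial_succ]
  simp

lemma shiftedFactorial_pos {a : ℝ} (ha : 0 < a) (n : ℕ) : 0 < shiftedFactorial a n :=
  ascPochhammer_pos n a ha

/-- Positivity at `a + k`, with `a > -1`: the product is empty for `k = 0`. -/
lemma shiftedFactorial_nat_add_pos {a : ℝ} (ha : -1 < a) (k : ℕ) :
    0 < shiftedFactorial (k + a) k := by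
  rcases k with _ | k
  · simp
  · refine shiftedFactorial_pos ?_ _
    push_cast
    have : (0 : ℝ) ≤ k := k.cast_nonneg
    linarith

lemma shiftedFactorial_one (n : ℕ) : shiftedFactorial 1 n = n.factorial := by
  simp [shiftedFactorial]

lemma shiftedFactorial_neg_natCast (k m : ℕ) :
    shiftedFactorial (-(k : ℝ)) m = (-1) ^ m * (m.factorial * k.choose m) := by
  rw [shiftedFactorial, ascPochhammer_eval_neg_eq_descPochhammer,
    descPochhammer_eval_eq_descFactorial, Nat.descFactorial_eq_factorial_mul_choose]
  push_cast
  ring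

/-- The Chu–Vandermonde identity, with the denominators cleared. -/
lemma sum_choose_mul_shiftedFactorial (k : ℕ) (b c : ℝ) :
    ∑ m ∈ Finset.range (k + 1), (-1) ^ m * (k.choose m : ℝ) * shiftedFactorial b m *
      shiftedFactorial (c + m) (k - m) = shiftedFactorial (c - b) k := by
  induction k generalizing b c with
  | zero => simp
  | succ k ih =>
    -- Pascal's rule splits the sum into the sums for `(b, c)` and `(b + 1, c + 1)`
    have h1 : ∑ m ∈ Finset.range (k + 2), (-1) ^ m * (k.choose m : ℝ) * shiftedFactorial b m *
        shiftedFactorial (c + m) (k + 1 - m) = (c + k) * shiftedFactorial (c - b) k := by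
      rw [Finset.sum_range_succ, Nat.choose_succ_self, ← ih b c, Finset.mul_sum]
      simp only [Nat.cast_zero, mul_zero, zero_mul, add_zero]
      refine Finset.sum_congr rfl fun m hm => ?_
      have hm' : m ≤ k := by simpa [Nat.lt_succ_iff] using hm
      rw [Nat.sub_add_comm hm', shiftedFactorial_succ, Nat.cast_sub hm']
      ring
    have h2 : ∑ m ∈ Finset.range (k + 1), (-1) ^ (m + 1) * (k.choose m : ℝ) *
        shiftedFactorial b (m + 1) * shiftedFactorial (c + (m + 1 : ℕ)) (k + 1 - (m + 1)) =
        -b * shiftedFactorial (c - b) k := by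
      have := ih (b + 1) (c + 1)
      rw [add_sub_add_right_eq_sub] at this
      rw [← this, Finset.mul_sum]
      refine Finset.sum_congr rfl fun m _ => ?_
      rw [shiftedFactorial_succ_left, Nat.add_sub_add_right]
      push_cast
      rw [show c + ((m : ℝ) + 1) = c + 1 + m by ring]
      ring
    rw [Finset.sum_range_succ'] at h1 ⊢
    have h3 : ∀ m : ℕ, ((k + 1).choose (m + 1) : ℝ) = k.choose (m + 1) + k.choose m := fun m => by
      rw [Nat.choose_succ_succ]; push_cast; ring
    simp only [h3, mul_add, add_mul, Finset.sum_add_distrib]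
    rw [h2, shiftedFactorial_succ]
    simp only [Nat.choose_zero_right] at h1 ⊢
    linear_combination h1

lemma ordinaryHypergeometric_neg_natCast (k : ℕ) (b c x : ℝ) :
    ordinaryHypergeometric (-(k : ℝ)) b c x =
      ∑ m ∈ Finset.range (k + 1),
        (-1) ^ m * (k.choose m : ℝ) * (shiftedFactorial b m / shiftedFactorial c m) * x ^ m := by
  rw [ordinaryHypergeometric_eq_tsum]
  have key : ∀ m : ℕ, ((m.factorial : ℝ)⁻¹ * (ascPochhammer ℝ m).eval (-(k : ℝ)) *
      (ascPochhammer ℝ m).eval b * ((ascPochhammer ℝ m).eval c)⁻¹) • x ^ m =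
      (-1) ^ m * (k.choose m : ℝ) * (shiftedFactorial b m / shiftedFactorial c m) * x ^ m := by
    intro m
    have := shiftedFactorial_neg_natCast k m
    rw [shiftedFactorial] at this
    have hm : (m.factorial : ℝ) ≠ 0 := by positivity
    rw [this, smul_eq_mul, shiftedFactorial, shiftedFactorial, div_eq_mul_inv]
    field_simp
  simp only [key]
  refine tsum_eq_sum fun m hm => ?_
  rw [Nat.choose_eq_zero_of_lt (by simpa using hm)]
  simp

/-! ### The moment functional of the Jacobi weight -/

open Polynomial in
/-- The normalized moment functional of the Jacobi weight in the variable `X = (1 + x) / 2`,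
given by its moments `(β + 1)_k / (α + β + 2)_k`. -/
def jacobiFunctional (α β : ℝ) : ℝ[X] →ₗ[ℝ] ℝ :=
  (Polynomial.basisMonomials ℝ).constr ℝ fun k =>
    shiftedFactorial (β + 1) k / shiftedFactorial (α + β + 2) k

section
open Polynomial
variable {α β : ℝ}

lemma jacobiFunctional_X_pow (k : ℕ) :
    jacobiFunctional α β (X ^ k) =
      shiftedFactorial (β + 1) k / shiftedFactorial (α + β + 2) k := by
  have := (Polynomial.basisMonomials ℝ).constr_basis ℝ (fun k =>
    shiftedFactorial (β + 1) k / shiftedFactorial (α + β + 2) k) k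
  simp only [Polynomial.coe_basisMonomials, ← Polynomial.X_pow_eq_monomial] at this
  exact this

/-- The Beta integral, in the algebraic form needed: induction on `m` replaces the integral. -/
lemma jacobiFunctional_one_sub_X_pow_mul_X_pow (hα : -1 < α) (hβ : -1 < β) (m j : ℕ) :
    jacobiFunctional α β ((1 - X) ^ m * X ^ j) =
      shiftedFactorial (α + 1) m * shiftedFactorial (β + 1) j /
        shiftedFactorial (α + β + 2) (m + j) := by
  induction m generalizing j with
  | zero => simp [jacobiFunctional_X_pow]
  | succ m ih =>
    rw [show (1 - X : ℝ[X]) ^ (m + 1) * X ^ j =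
      (1 - X) ^ m * X ^ j - (1 - X) ^ m * X ^ (j + 1) by ring, map_sub, ih, ih,
      ← add_assoc, show m + 1 + j = m + j + 1 by ring, shiftedFactorial_succ,
      shiftedFactorial_succ, shiftedFactorial_succ]
    have h1 := (shiftedFactorial_pos (a := α + β + 2) (by linarith) (m + j)).ne'
    have h2 : α + β + 2 + ((m + j : ℕ) : ℝ) ≠ 0 := by
      have : (0 : ℝ) ≤ ((m + j : ℕ) : ℝ) := Nat.cast_nonneg _
      linarith
    push_cast at h2 ⊢
    field_simp
    ring

lemma jacobiHankel_apply (n : ℕ) (i j : Fin (n + 1)) :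
    jacobiHankel α β n i j = jacobiFunctional α β ((1 - 2 * X) ^ ((i : ℕ) + (j : ℕ))) := by
  rw [jacobiHankel, Matrix.of_apply,
    show -((i : ℕ) : ℝ) - ((j : ℕ) : ℝ) = -(((i : ℕ) + (j : ℕ) : ℕ) : ℝ) by push_cast; ring,
    ordinaryHypergeometric_neg_natCast, sub_eq_neg_add, add_pow, map_sum]
  refine Finset.sum_congr rfl fun m _ => ?_
  rw [show (-(2 * X) : ℝ[X]) ^ m * 1 ^ ((i : ℕ) + (j : ℕ) - m) *
      ((((i : ℕ) + (j : ℕ)).choose m : ℕ) : ℝ[X])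
    = C ((-2) ^ m * ((((i : ℕ) + (j : ℕ)).choose m : ℕ) : ℝ)) * X ^ m by
      simp only [one_pow, C_mul, C_pow, C_neg, map_ofNat, map_natCast]; ring, ← smul_eq_C_mul,
    map_smul, jacobiFunctional_X_pow, smul_eq_mul, neg_pow (2 : ℝ)]
  ring

/-! ### Orthogonality of the Jacobi polynomials -/

/-- The coefficients of the Jacobi polynomial `P_k^{(α, β)}` in powers of `(1 - x) / 2`. -/
def jacobiCoeff (α β : ℝ) (k m : ℕ) : ℝ :=
  shiftedFactorial (α + 1) k / k.factorial *
    ((-1) ^ m * k.choose m * (shiftedFactorial (k + α + β + 1) m / shiftedFactorial (α + 1) m))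

/-- The Jacobi polynomial `P_k^{(α, β)}` as a polynomial in `X = (1 + x) / 2`. -/
def jacobiPoly (α β : ℝ) (k : ℕ) : ℝ[X] :=
  ∑ m ∈ Finset.range (k + 1), C (jacobiCoeff α β k m) * (1 - X) ^ m

lemma natDegree_one_sub_X_pow_le (m : ℕ) : ((1 - X : ℝ[X]) ^ m).natDegree ≤ m := by
  refine natDegree_pow_le.trans ?_
  have : (1 - X : ℝ[X]).natDegree ≤ 1 := by compute_degree
  nlinarith

lemma natDegree_jacobiPoly_le (k : ℕ) : (jacobiPoly α β k).natDegree ≤ k := by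
  refine natDegree_sum_le_of_forall_le _ _ fun m hm => (natDegree_C_mul_le _ _).trans ?_
  exact (natDegree_one_sub_X_pow_le m).trans (by simpa [Nat.lt_succ_iff] using hm)

lemma coeff_one_sub_X_pow_self (m : ℕ) : ((1 - X : ℝ[X]) ^ m).coeff m = (-1) ^ m := by
  have h : (1 - X : ℝ[X]).natDegree ≤ 1 := by compute_degree
  have := coeff_pow_of_natDegree_le (m := m) h
  simpa [coeff_one] using this

lemma coeff_jacobiPoly_self (hα : -1 < α) (k : ℕ) :
    (jacobiPoly α β k).coeff k = shiftedFactorial (k + α + β + 1) k / k.factorial := by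
  have h1 := (shiftedFactorial_pos (a := α + 1) (by linarith) k).ne'
  rw [jacobiPoly, finsetSum_coeff, Finset.sum_range_succ, Finset.sum_eq_zero, zero_add, coeff_C_mul,
    coeff_one_sub_X_pow_self, jacobiCoeff, Nat.choose_self]
  · have : ((-1 : ℝ) ^ k) * (-1) ^ k = 1 := by rw [← mul_pow]; simp
    field_simp
    linear_combination shiftedFactorial (k + α + β + 1) k * this
  · intro m hm
    rw [coeff_C_mul, coeff_eq_zero_of_natDegree_lt, mul_zero]
    exact (natDegree_one_sub_X_pow_le m).trans_lt (by simpa using hm)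

lemma jacobiFunctional_jacobiPoly_mul_X_pow (hα : -1 < α) (hβ : -1 < β) (k j : ℕ) :
    jacobiFunctional α β (jacobiPoly α β k * X ^ j) =
      shiftedFactorial (α + 1) k * shiftedFactorial (β + 1) j *
        shiftedFactorial (j + 1 - k) k /
        (k.factorial * shiftedFactorial (α + β + 2) (j + k)) := by
  have hs : 0 < α + β + 2 := by linarith
  have hf : (k.factorial : ℝ) ≠ 0 := by positivity
  -- the sum over the coefficients is a Chu–Vandermonde sum
  have hcv := sum_choose_mul_shiftedFactorial k (k + α + β + 1) (α + β + 2 + j)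
  rw [show α + β + 2 + (j : ℝ) - (k + α + β + 1) = j + 1 - k by ring] at hcv
  rw [← hcv, jacobiPoly, Finset.sum_mul, map_sum, Finset.mul_sum, Finset.sum_div]
  refine Finset.sum_congr rfl fun m hm => ?_
  have hm' : m ≤ k := by simpa [Nat.lt_succ_iff] using hm
  have h1 := (shiftedFactorial_pos (a := α + 1) (by linarith) m).ne'
  have h2 := (shiftedFactorial_pos hs (m + j)).ne'
  have h3 := (shiftedFactorial_pos hs (j + k)).ne'
  have h4 : shiftedFactorial (α + β + 2) (j + k) = shiftedFactorial (α + β + 2) (m + j) *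
      shiftedFactorial (α + β + 2 + j + m) (k - m) := by
    rw [show j + k = m + j + (k - m) by omega, shiftedFactorial_add]
    push_cast
    rw [show α + β + 2 + ((m : ℝ) + j) = α + β + 2 + j + m by ring]
  rw [mul_assoc, ← smul_eq_C_mul, map_smul,
    jacobiFunctional_one_sub_X_pow_mul_X_pow hα hβ, smul_eq_mul, jacobiCoeff]
  rw [h4] at h3 ⊢
  have h5 := right_ne_zero_of_mul h3
  field_simp

/-- The squared norm of `P_k^{(α, β)}` with respect to the normalized Jacobi weight. -/
def jacobiNorm (α β : ℝ) (k : ℕ) : ℝ :=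
  shiftedFactorial (k + α + β + 1) k * shiftedFactorial (α + 1) k * shiftedFactorial (β + 1) k /
    (k.factorial * shiftedFactorial (α + β + 2) (2 * k))

/-- Only the leading coefficient of a polynomial of degree at most `k` is seen by `P_k`. -/
lemma jacobiFunctional_jacobiPoly_mul (hα : -1 < α) (hβ : -1 < β) {k : ℕ} {p : ℝ[X]}
    (hp : p.natDegree ≤ k) :
    jacobiFunctional α β (jacobiPoly α β k * p) =
      p.coeff k * (shiftedFactorial (α + 1) k * shiftedFactorial (β + 1) k /
        shiftedFactorial (α + β + 2) (2 * k)) := by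
  conv_lhs => rw [p.as_sum_range_C_mul_X_pow' (Nat.lt_succ_of_le hp), Finset.mul_sum, map_sum]
  simp only [← smul_eq_C_mul, mul_smul_comm, map_smul,
    jacobiFunctional_jacobiPoly_mul_X_pow hα hβ, smul_eq_mul]
  rw [Finset.sum_range_succ, Finset.sum_eq_zero, zero_add, add_sub_cancel_left,
    shiftedFactorial_one, ← two_mul]
  · have : (k.factorial : ℝ) ≠ 0 := by positivity
    field_simp
  · intro j hj
    have hj' : j < k := by simpa using hj
    have : (j : ℝ) + 1 - k = -((k - 1 - j : ℕ) : ℝ) := by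
      rw [Nat.cast_sub (by omega), Nat.cast_sub (by omega)]; push_cast; ring
    rw [this, shiftedFactorial_neg_natCast, Nat.choose_eq_zero_of_lt (by omega)]
    simp

lemma jacobiFunctional_jacobiPoly_mul_jacobiPoly (hα : -1 < α) (hβ : -1 < β) (k l : ℕ) :
    jacobiFunctional α β (jacobiPoly α β k * jacobiPoly α β l) =
      if k = l then jacobiNorm α β k else 0 := by
  wlog hkl : l ≤ k generalizing k l with H
  · rw [mul_comm, H l k (by omega), if_neg (by omega), if_neg (by omega)]
  rw [jacobiFunctional_jacobiPoly_mul hα hβ ((natDegree_jacobiPoly_le l).trans hkl)]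
  split_ifs with h
  · subst h
    rw [coeff_jacobiPoly_self hα, jacobiNorm]
    have := (shiftedFactorial_pos (a := α + β + 2) (by linarith) (2 * k)).ne'
    field_simp
  · rw [coeff_eq_zero_of_natDegree_lt ((natDegree_jacobiPoly_le l).trans_lt (by omega)), zero_mul]

end

/-! ### The Hankel matrix and its inverse -/

section
open Polynomial Matrix
variable {α β : ℝ}

/-- The coefficient of `(-x)^i` in `P_k^{(α, β)}(x)`, by Taylor's formula at `x = 0` and
`dⁱ/dxⁱ P_k^{(α, β)} = 2⁻ⁱ (k + α + β + 1)_i P_{k-i}^{(α+i, β+i)}`. -/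
def jacobiTaylorCoeff (α β : ℝ) (k i : ℕ) : ℝ :=
  if i ≤ k then shiftedFactorial (k + α + β + 1) i * jacobiP (k - i) (α + i) (β + i) 0 /
    ((-2) ^ i * i.factorial) else 0

/-- Differentiating the hypergeometric sum of `P_k` termwise `i` times gives, up to a factor, that of
`P_{k-i}^{(α+i, β+i)}`. -/
lemma jacobiTaylorCoeff_eq_sum (hα : -1 < α) {k i : ℕ} (hik : i ≤ k) :
    jacobiTaylorCoeff α β k i = ∑ l ∈ Finset.range (k - i + 1),
      jacobiCoeff α β k (i + l) * ((i + l).choose i * (1 / 2) ^ (i + l)) := by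
  obtain ⟨d, rfl⟩ := Nat.exists_eq_add_of_le hik
  rw [jacobiTaylorCoeff, if_pos hik, jacobiP, ordinaryHypergeometric_neg_natCast,
    Nat.add_sub_cancel_left, Finset.mul_sum, Finset.mul_sum, Finset.sum_div]
  refine Finset.sum_congr rfl fun l hl => ?_
  obtain ⟨e, rfl⟩ := Nat.exists_eq_add_of_le (show l ≤ d by simpa [Nat.lt_succ_iff] using hl)
  have hi : 0 < α + 1 + i := by have : (0 : ℝ) ≤ i := i.cast_nonneg; linarith
  have h1 := (shiftedFactorial_pos (a := α + 1) (by linarith) i).ne'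
  have h2 := (shiftedFactorial_pos hi l).ne'
  have h3 : (((i + l).choose i : ℕ) : ℝ) = (i + l).factorial / (i.factorial * l.factorial) := by
    rw [Nat.cast_add_choose]
  have h4 : (((l + e).choose l : ℕ) : ℝ) = (l + e).factorial / (l.factorial * e.factorial) := by
    rw [Nat.cast_add_choose]
  have h5 : (((i + (l + e)).choose (i + l) : ℕ) : ℝ) =
      (i + (l + e)).factorial / ((i + l).factorial * e.factorial) := by
    rw [← add_assoc, Nat.cast_add_choose]
  rw [jacobiCoeff, h3, h4, h5, shiftedFactorial_add (α + 1) i l,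
    shiftedFactorial_add (α + 1) i (l + e), shiftedFactorial_add _ i l]
  rw [show α + (i : ℝ) + 1 = α + 1 + i by ring,
    show ((l + e : ℕ) : ℝ) + (α + i) + (β + i) + 1 = ((i + (l + e) : ℕ) : ℝ) + α + β + 1 + i by
      push_cast; ring]
  have f1 : ((i + (l + e)).factorial : ℝ) ≠ 0 := by positivity
  have f2 : ((i + l).factorial : ℝ) ≠ 0 := by positivity
  have f3 : ((l + e).factorial : ℝ) ≠ 0 := by positivity
  have f4 : (i.factorial : ℝ) ≠ 0 := by positivity
  have f5 : (l.factorial : ℝ) ≠ 0 := by positivity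
  have f6 : (e.factorial : ℝ) ≠ 0 := by positivity
  rw [show (-2 : ℝ) ^ i = (-1) ^ i * 2 ^ i by rw [← mul_pow]; norm_num, sub_zero, one_div,
    inv_pow, inv_pow, pow_add, pow_add]
  have h6 : ((-1 : ℝ) ^ i) * (-1) ^ i = 1 := by rw [← mul_pow]; simp
  have h7 : (-1 : ℝ) ^ i ≠ 0 := by simp
  field_simp
  linear_combination (-shiftedFactorial (((i + (l + e) : ℕ) : ℝ) + α + β + 1) i *
    shiftedFactorial (α + 1 + i) (l + e) *
    shiftedFactorial (((i + (l + e) : ℕ) : ℝ) + α + β + 1 + i) l) * h6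

/-- The Taylor expansion of `P_k^{(α, β)}` at `x = 0`; here `1 - 2 * X` stands for `-x`. -/
lemma jacobiPoly_eq_sum (hα : -1 < α) {n k : ℕ} (hk : k ≤ n) :
    jacobiPoly α β k =
      ∑ i : Fin (n + 1), C (jacobiTaylorCoeff α β k i) * (1 - 2 * X) ^ (i : ℕ) := by
  rw [Fin.sum_univ_eq_sum_range (fun i => C (jacobiTaylorCoeff α β k i) * (1 - 2 * X) ^ i) (n + 1),
    ← Finset.sum_subset (Finset.range_subset_range.2 (Nat.succ_le_succ hk)) (fun i _ hi => by
      rw [jacobiTaylorCoeff, if_neg (by simpa [Nat.lt_succ_iff] using hi), C_0, zero_mul])]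
  -- expand `(1 - X)^m = 2⁻ᵐ (1 + (1 - 2X))^m` and exchange the two summations
  have h1 : ∀ m ∈ Finset.range (k + 1), C (jacobiCoeff α β k m) * (1 - X) ^ m =
      ∑ i ∈ Finset.range (m + 1),
        C (jacobiCoeff α β k m * (m.choose i * (1 / 2) ^ m)) * (1 - 2 * X) ^ i := by
    intro m _
    have h2 : (1 - X : ℝ[X]) = C (1 / 2) * ((1 - 2 * X) + 1) := by
      have : (C (1 / 2) : ℝ[X]) * 2 = 1 := by
        rw [← map_ofNat C, ← C_mul]; norm_num
      linear_combination (X - 1) * this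
    rw [h2, mul_pow, add_pow, Finset.mul_sum, Finset.mul_sum]
    refine Finset.sum_congr rfl fun i _ => ?_
    simp only [one_pow, C_mul, C_pow, map_natCast]
    ring
  have h2 : ∀ i ∈ Finset.range (k + 1), C (jacobiTaylorCoeff α β k i) * (1 - 2 * X) ^ i =
      ∑ l ∈ Finset.range (k - i + 1), C (jacobiCoeff α β k (i + l) *
        ((i + l).choose i * (1 / 2) ^ (i + l))) * (1 - 2 * X) ^ i := fun i hi => by
    rw [jacobiTaylorCoeff_eq_sum hα (by simpa [Nat.lt_succ_iff] using hi), map_sum, Finset.sum_mul]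
  rw [jacobiPoly, Finset.sum_congr rfl h1, Finset.sum_congr rfl h2, Finset.sum_sigma',
    Finset.sum_sigma']
  refine Finset.sum_nbij' (fun x => ⟨x.2, x.1 - x.2⟩) (fun x => ⟨x.1 + x.2, x.1⟩) ?_ ?_ ?_ ?_ ?_
  · rintro ⟨m, i⟩ h
    simp only [Finset.mem_sigma, Finset.mem_range] at h ⊢
    omega
  · rintro ⟨m, i⟩ h
    simp only [Finset.mem_sigma, Finset.mem_range] at h ⊢
    omega
  · rintro ⟨m, i⟩ h
    simp only [Finset.mem_sigma, Finset.mem_range] at h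
    simp only [Sigma.mk.injEq, heq_eq_eq, and_true]
    omega
  · rintro ⟨m, i⟩ _
    simp
  · rintro ⟨m, i⟩ h
    simp only [Finset.mem_sigma, Finset.mem_range] at h
    simp only [show i + (m - i) = m by omega]

/-- The lower triangular matrix of the Taylor coefficients of `P_0, …, P_n` at `0`. -/
def jacobiTaylorMatrix (α β : ℝ) (n : ℕ) : Matrix (Fin (n + 1)) (Fin (n + 1)) ℝ :=
  Matrix.of fun k i => jacobiTaylorCoeff α β k i

/-- Orthogonality, read as a congruence that diagonalizes the Hankel matrix. -/
lemma jacobiTaylorMatrix_mul_jacobiHankel_mul (hα : -1 < α) (hβ : -1 < β) (n : ℕ) :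
    jacobiTaylorMatrix α β n * jacobiHankel α β n * (jacobiTaylorMatrix α β n)ᵀ =
      Matrix.diagonal fun k : Fin (n + 1) => jacobiNorm α β k := by
  ext k l
  have h := jacobiFunctional_jacobiPoly_mul_jacobiPoly hα hβ (k : ℕ) l
  rw [jacobiPoly_eq_sum hα (Nat.lt_succ_iff.1 k.2), jacobiPoly_eq_sum hα (Nat.lt_succ_iff.1 l.2),
    Finset.sum_mul_sum, map_sum, Finset.sum_congr rfl (fun i _ => map_sum _ _ _)] at h
  rw [Matrix.diagonal_apply, mul_apply]
  simp only [mul_apply, Finset.sum_mul, transpose_apply, jacobiHankel_apply]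
  rw [Finset.sum_comm]
  simp only [Fin.val_inj] at h
  rw [← h]
  refine Finset.sum_congr rfl fun i _ => Finset.sum_congr rfl fun j _ => ?_
  rw [show C (jacobiTaylorCoeff α β k i) * (1 - 2 * X) ^ (i : ℕ) *
    (C (jacobiTaylorCoeff α β l j) * (1 - 2 * X) ^ (j : ℕ)) =
    C (jacobiTaylorCoeff α β k i * jacobiTaylorCoeff α β l j) * (1 - 2 * X) ^ ((i : ℕ) + j) by
      rw [C_mul, pow_add]; ring, ← smul_eq_C_mul, map_smul, smul_eq_mul]
  simp only [jacobiTaylorMatrix, Matrix.of_apply]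
  ring

lemma jacobiNorm_pos (hα : -1 < α) (hβ : -1 < β) (k : ℕ) : 0 < jacobiNorm α β k := by
  have h1 := shiftedFactorial_pos (a := α + 1) (by linarith) k
  have h2 := shiftedFactorial_pos (a := β + 1) (by linarith) k
  have h3 := shiftedFactorial_pos (a := α + β + 2) (by linarith) (2 * k)
  have h4 := shiftedFactorial_nat_add_pos (a := α + β + 1) (by linarith) k
  rw [show (k : ℝ) + (α + β + 1) = k + α + β + 1 by ring] at h4
  rw [jacobiNorm]
  positivity

lemma jacobiTaylorCoeff_self (k : ℕ) :
    jacobiTaylorCoeff α β k k =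
      shiftedFactorial (k + α + β + 1) k / ((-2) ^ k * k.factorial) := by
  have : jacobiP 0 (α + k) (β + k) 0 = 1 := by
    have h := ordinaryHypergeometric_neg_natCast 0 (((0 : ℕ) : ℝ) + (α + k) + (β + k) + 1)
      (α + k + 1) ((1 - 0) / 2)
    rw [jacobiP, h]
    simp
  rw [jacobiTaylorCoeff, if_pos le_rfl, Nat.sub_self, this, mul_one]

lemma det_jacobiTaylorMatrix (n : ℕ) :
    (jacobiTaylorMatrix α β n).det = ∏ k ∈ Finset.range (n + 1), jacobiTaylorCoeff α β k k := by
  rw [← Fin.prod_univ_eq_prod_range (fun k => jacobiTaylorCoeff α β k k)]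
  refine det_of_isLowerTriangular _ fun i j hij => ?_
  have hij' : i < j := hij
  rw [jacobiTaylorMatrix, of_apply, jacobiTaylorCoeff, if_neg (by simpa using hij')]

lemma det_jacobiHankel_mul (hα : -1 < α) (hβ : -1 < β) (n : ℕ) :
    (jacobiHankel α β n).det * (∏ k ∈ Finset.range (n + 1), jacobiTaylorCoeff α β k k) ^ 2 =
      ∏ k ∈ Finset.range (n + 1), jacobiNorm α β k := by
  have h := congrArg Matrix.det (jacobiTaylorMatrix_mul_jacobiHankel_mul hα hβ n)
  rw [det_mul, det_mul, det_transpose, det_diagonal, det_jacobiTaylorMatrix,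
    Fin.prod_univ_eq_prod_range (fun k => jacobiNorm α β k)] at h
  rw [← h]
  ring

lemma det_jacobiHankel_ne_zero (hα : -1 < α) (hβ : -1 < β) (n : ℕ) :
    (jacobiHankel α β n).det ≠ 0 := by
  have h := det_jacobiHankel_mul hα hβ n
  refine left_ne_zero_of_mul (b := _ ^ 2) (h.trans_ne ?_)
  exact (Finset.prod_pos fun k _ => jacobiNorm_pos hα hβ k).ne'

/-- The ratio of consecutive Hankel determinants is the squared norm of the monic orthogonal
polynomial. -/
lemma det_jacobiHankel_succ (hα : -1 < α) (hβ : -1 < β) (n : ℕ) :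
    (jacobiHankel α β (n + 1)).det = (jacobiHankel α β n).det *
      (jacobiNorm α β (n + 1) / jacobiTaylorCoeff α β (n + 1) (n + 1) ^ 2) := by
  have h1 := det_jacobiHankel_mul hα hβ n
  have h2 := det_jacobiHankel_mul hα hβ (n + 1)
  have h3 : (∏ k ∈ Finset.range (n + 2), jacobiTaylorCoeff α β k k) ^ 2 ≠ 0 := fun h => by
    rw [h, mul_zero] at h2
    exact (Finset.prod_pos fun k _ => jacobiNorm_pos hα hβ k).ne h2
  rw [Finset.prod_range_succ, mul_pow] at h3
  rw [Finset.prod_range_succ _ (n + 1), Finset.prod_range_succ _ (n + 1), ← h1] at h2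
  have h4 := left_ne_zero_of_mul h3
  have h5 := right_ne_zero_of_mul h3
  rw [mul_div_assoc', eq_div_iff h5]
  refine mul_left_cancel₀ h4 ?_
  linear_combination h2

lemma det_jacobiHankel_zero : (jacobiHankel α β 0).det = 1 := by
  rw [det_fin_one (A := jacobiHankel α β 0), jacobiHankel_apply]
  have := jacobiFunctional_X_pow (α := α) (β := β) 0
  simpa using this

lemma inv_jacobiHankel_apply (hα : -1 < α) (hβ : -1 < β) (hαβ : α + β ≠ -1) (n : ℕ)
    (i j : Fin (n + 1)) : (jacobiHankel α β n)⁻¹ i j = jacobiHankelInv α β n i j := by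
  set A := jacobiTaylorMatrix α β n with hA
  set H := jacobiHankel α β n
  set D := Matrix.diagonal fun k : Fin (n + 1) => (jacobiNorm α β k)⁻¹
  have hD : D * (A * H * Aᵀ) = 1 := by
    rw [jacobiTaylorMatrix_mul_jacobiHankel_mul hα hβ, diagonal_mul_diagonal, ← diagonal_one]
    congr 1
    ext k
    exact inv_mul_cancel₀ (jacobiNorm_pos hα hβ k).ne'
  have hinv : H⁻¹ = Aᵀ * D * A := by
    refine inv_eq_left_inv ?_
    rw [← Matrix.mul_assoc, mul_eq_one_comm] at hD
    rw [← hD]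
    simp only [Matrix.mul_assoc]
  rw [hinv, mul_apply]
  simp only [D, mul_diagonal, transpose_apply, hA, jacobiTaylorMatrix, of_apply]
  rw [Fin.sum_univ_eq_sum_range (fun k => jacobiTaylorCoeff α β k i * (jacobiNorm α β k)⁻¹ *
    jacobiTaylorCoeff α β k j), jacobiHankelInv]
  symm
  refine Finset.sum_subset_zero_on_sdiff (fun k hk => ?_) (fun k hk => ?_) (fun k hk => ?_)
  · simp only [Finset.mem_Icc, Finset.mem_range] at hk ⊢
    omega
  · simp only [Finset.mem_sdiff, Finset.mem_Icc, Finset.mem_range, not_and_or, not_le] at hk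
    rcases lt_max_iff.1 (hk.2.resolve_right (by omega)) with h | h
    · simp [jacobiTaylorCoeff, h.not_ge]
    · simp [jacobiTaylorCoeff, h.not_ge]
  · obtain ⟨h1, h2⟩ := max_le_iff.1 (Finset.mem_Icc.1 hk).1
    rw [jacobiTaylorCoeff, jacobiTaylorCoeff, if_pos h1, if_pos h2, jacobiNorm]
    have hs : α + β + 1 ≠ 0 := fun h => hαβ (by linarith)
    have p1 := (shiftedFactorial_pos (a := α + 1) (by linarith) k).ne'
    have p2 := (shiftedFactorial_pos (a := β + 1) (by linarith) k).ne'
    have p3 := (shiftedFactorial_pos (a := α + β + 2) (by linarith) (2 * k)).ne'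
    have p4 := (shiftedFactorial_nat_add_pos (a := α + β + 1) (by linarith) k).ne'
    rw [show (k : ℝ) + (α + β + 1) = k + α + β + 1 by ring] at p4
    -- `(s + 1)_{2k + 1}`, with `s = α + β`, factored in two ways
    have key : shiftedFactorial (α + β + 1) k * shiftedFactorial (k + α + β + 1) k *
        (2 * k + α + β + 1) = (α + β + 1) * shiftedFactorial (α + β + 2) (2 * k) := by
      have e1 := shiftedFactorial_succ_left (α + β + 1) (2 * k)
      rw [shiftedFactorial_succ, two_mul, shiftedFactorial_add,
        show α + β + 1 + (k : ℝ) = k + α + β + 1 by ring,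
        show α + β + 1 + 1 = α + β + 2 by ring] at e1
      rw [two_mul k, ← e1]
      push_cast
      ring
    have q1 : (k.factorial : ℝ) ≠ 0 := by positivity
    rw [pow_add]
    have q2 : ((-2 : ℝ) ^ (i : ℕ)) ≠ 0 := by simp
    have q3 : ((-2 : ℝ) ^ (j : ℕ)) ≠ 0 := by simp
    field_simp
    linear_combination ((shiftedFactorial (k + α + β + 1) i * jacobiP (k - i) (α + i) (β + i) 0) *
      (shiftedFactorial (k + α + β + 1) j * jacobiP (k - j) (α + j) (β + j) 0)) * key

end

/-! ### The moments of the Jacobi weight -/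

section
open Polynomial MeasureTheory
variable {α β : ℝ}

lemma shiftedFactorial_mul_Gamma {a : ℝ} (ha : 0 < a) (n : ℕ) :
    shiftedFactorial a n * Real.Gamma a = Real.Gamma (a + n) := by
  induction n with
  | zero => simp
  | succ n ih =>
    have : a + n ≠ 0 := by positivity
    rw [shiftedFactorial_succ, Nat.cast_succ, ← add_assoc, Real.Gamma_add_one this, ← ih]
    ring

lemma intervalIntegrable_and_integral_rpow_mul_one_sub_rpow {a b : ℝ} (ha : -1 < a) (hb : -1 < b) :
    IntervalIntegrable (fun u : ℝ => u ^ a * (1 - u) ^ b) volume 0 1 ∧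
      ∫ u in (0 : ℝ)..1, u ^ a * (1 - u) ^ b =
        Real.Gamma (a + 1) * Real.Gamma (b + 1) / Real.Gamma (a + b + 2) := by
  have h : ∀ u ∈ Set.uIcc (0 : ℝ) 1, (u : ℂ) ^ (((a + 1 : ℝ) : ℂ) - 1) *
      (1 - (u : ℂ)) ^ (((b + 1 : ℝ) : ℂ) - 1) = ((u ^ a * (1 - u) ^ b : ℝ) : ℂ) := by
    intro u hu
    rw [Set.uIcc_of_le zero_le_one] at hu
    rw [Complex.ofReal_mul, Complex.ofReal_cpow hu.1, Complex.ofReal_cpow (by linarith [hu.2])]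
    push_cast
    simp
  have ha' : 0 < ((a + 1 : ℝ) : ℂ).re := by rw [Complex.ofReal_re]; linarith
  have hb' : 0 < ((b + 1 : ℝ) : ℂ).re := by rw [Complex.ofReal_re]; linarith
  constructor
  · have h1 := Complex.betaIntegral_convergent ha' hb'
    have h2 := h1.congr (fun u hu => h u (Set.uIoc_subset_uIcc hu))
    rw [intervalIntegrable_iff] at h2 ⊢
    exact h2.re
  · have h1 := Complex.betaIntegral_eq_Gamma_mul_div _ _ ha' hb'
    rw [Complex.betaIntegral, intervalIntegral.integral_congr h, intervalIntegral.integral_ofReal,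
      ← Complex.ofReal_add, Complex.Gamma_ofReal, Complex.Gamma_ofReal, Complex.Gamma_ofReal,
      show a + 1 + (b + 1) = a + b + 2 by ring] at h1
    exact_mod_cast h1

/-- Up to the total mass, `jacobiFunctional` is integration against the Jacobi weight, moved to
`[0, 1]` by `u = (1 + x) / 2`. -/
lemma intervalIntegrable_and_integral_eval_mul (hα : -1 < α) (hβ : -1 < β) (p : ℝ[X]) :
    IntervalIntegrable (fun u : ℝ => p.eval u * (u ^ β * (1 - u) ^ α)) volume 0 1 ∧
      ∫ u in (0 : ℝ)..1, p.eval u * (u ^ β * (1 - u) ^ α) =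
        Real.Gamma (β + 1) * Real.Gamma (α + 1) / Real.Gamma (β + α + 2) *
          jacobiFunctional α β p := by
  induction p using Polynomial.induction_on' with
  | add p q hp hq =>
    simp only [eval_add, add_mul]
    refine ⟨hp.1.add hq.1, ?_⟩
    rw [intervalIntegral.integral_add hp.1 hq.1, hp.2, hq.2, map_add]
    ring
  | monomial k c =>
    have h : ∀ u ∈ Set.uIoc (0 : ℝ) 1, c * (u ^ (β + k) * (1 - u) ^ α) =
        (monomial k c).eval u * (u ^ β * (1 - u) ^ α) := by
      intro u hu
      rw [Set.uIoc_of_le zero_le_one] at hu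
      rw [eval_monomial, Real.rpow_add_natCast hu.1.ne']
      ring
    have hk : -1 < β + k := by have : (0 : ℝ) ≤ k := k.cast_nonneg; linarith
    obtain ⟨h1, h2⟩ := intervalIntegrable_and_integral_rpow_mul_one_sub_rpow hk hα
    refine ⟨(h1.const_mul c).congr h, ?_⟩
    rw [← intervalIntegral.integral_congr_ae (ae_of_all _ h), intervalIntegral.integral_const_mul,
      h2, ← C_mul_X_pow_eq_monomial, ← smul_eq_C_mul, map_smul, jacobiFunctional_X_pow,
      show β + k + 1 = β + 1 + k by ring, show β + k + α + 2 = α + β + 2 + k by ring,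
      ← shiftedFactorial_mul_Gamma (by linarith), ← shiftedFactorial_mul_Gamma (by linarith),
      smul_eq_mul, add_comm β α]
    have := (Real.Gamma_pos_of_pos (s := α + β + 2) (by linarith)).ne'
    have := (shiftedFactorial_pos (a := α + β + 2) (by linarith) k).ne'
    field_simp

lemma jacobiMoment_eq (hα : -1 < α) (hβ : -1 < β) (m : ℕ) :
    jacobiMoment α β m = (2 ^ (α + β + 1) *
      (Real.Gamma (β + 1) * Real.Gamma (α + 1) / Real.Gamma (β + α + 2))) *
        ((-1) ^ m * jacobiFunctional α β ((1 - 2 * X) ^ m)) := by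
  have h1 : jacobiMoment α β m = 2 * ∫ u in (0 : ℝ)..1,
      (2 * u - 1) ^ m * ((1 - (2 * u - 1)) ^ α * (1 + (2 * u - 1)) ^ β) := by
    have := intervalIntegral.mul_integral_comp_mul_sub (a := 0) (b := 1)
      (f := fun x : ℝ => x ^ m * ((1 - x) ^ α * (1 + x) ^ β)) (c := 2) (d := 1)
    rw [this, jacobiMoment]
    norm_num
  have h2 : ∀ u ∈ Set.uIcc (0 : ℝ) 1,
      (2 * u - 1) ^ m * ((1 - (2 * u - 1)) ^ α * (1 + (2 * u - 1)) ^ β) =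
      (2 ^ (α + β) * (-1) ^ m) *
        (((1 - 2 * X : ℝ[X]) ^ m).eval u * (u ^ β * (1 - u) ^ α)) := by
    intro u hu
    rw [Set.uIcc_of_le zero_le_one] at hu
    rw [show 1 - (2 * u - 1) = 2 * (1 - u) by ring, show 1 + (2 * u - 1) = 2 * u by ring,
      Real.mul_rpow zero_le_two (by linarith [hu.2]), Real.mul_rpow zero_le_two hu.1,
      Real.rpow_add zero_lt_two, show 2 * u - 1 = -1 * (1 - 2 * u) by ring, mul_pow]
    simp only [eval_pow, eval_sub, eval_mul, eval_one, eval_ofNat, eval_X]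
    ring
  rw [h1, intervalIntegral.integral_congr h2, intervalIntegral.integral_const_mul,
    (intervalIntegrable_and_integral_eval_mul hα hβ _).2, Real.rpow_add_one two_ne_zero]
  ring

lemma jacobiMoment_zero_pos (hα : -1 < α) (hβ : -1 < β) : 0 < jacobiMoment α β 0 := by
  have h := jacobiFunctional_X_pow (α := α) (β := β) 0
  rw [shiftedFactorial_zero, shiftedFactorial_zero, pow_zero, div_one] at h
  rw [jacobiMoment_eq hα hβ, pow_zero, pow_zero, h]
  have h1 := Real.Gamma_pos_of_pos (s := α + 1) (by linarith)
  have h2 := Real.Gamma_pos_of_pos (s := β + 1) (by linarith)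
  have h3 := Real.Gamma_pos_of_pos (s := β + α + 2) (by linarith)
  positivity

lemma jacobiHankel_eq_jacobiMoment_div (hα : -1 < α) (hβ : -1 < β) (n : ℕ) (i j : Fin (n + 1)) :
    jacobiHankel α β n i j = (-1 : ℝ) ^ ((i : ℕ) + (j : ℕ)) *
      (jacobiMoment α β ((i : ℕ) + (j : ℕ)) / jacobiMoment α β 0) := by
  have h0 := (jacobiMoment_zero_pos hα hβ).ne'
  have h := jacobiFunctional_X_pow (α := α) (β := β) 0
  rw [shiftedFactorial_zero, shiftedFactorial_zero, pow_zero, div_one] at h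
  have h1 := jacobiMoment_eq hα hβ 0
  rw [pow_zero, pow_zero, h, mul_one, mul_one] at h1
  rw [jacobiMoment_eq hα hβ ((i : ℕ) + j), ← h1, jacobiHankel_apply, mul_div_cancel_left₀ _ h0,
    ← mul_assoc, ← mul_pow]
  simp

end

/-! ### The functional equation of the Barnes `G`-function -/

section
open Complex

/-- A logarithm of the factor of index `m + 1` in the Weierstrass product of `G (w + 1)`, taken
with the principal branch of `log (1 + w / (m + 1))`. -/
def barnesLogFactor (w : ℂ) (m : ℕ) : ℂ :=
  (m + 1) * log (1 + w / (m + 1)) + (-w + w ^ 2 / (2 * (m + 1)))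

/-- The exponential factor removes the first two terms of the logarithm series, so that the cubic
remainder is left. -/
lemma norm_barnesLogFactor_le {w : ℂ} {m : ℕ} (h : 2 * ‖w‖ ≤ m + 1) :
    ‖barnesLogFactor w m‖ ≤ ‖w‖ ^ 3 * (1 / ((m : ℝ) + 1) ^ 2) := by
  have hm : (0 : ℝ) < (m : ℝ) + 1 := by positivity
  have hm' : (m : ℂ) + 1 ≠ 0 := Nat.cast_add_one_ne_zero m
  have hn : ‖w / ((m : ℂ) + 1)‖ = ‖w‖ / (m + 1) := by
    rw [norm_div, ← Nat.cast_succ, Complex.norm_natCast, Nat.cast_succ]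
  have hle : ‖w‖ / ((m : ℝ) + 1) ≤ 1 / 2 := by
    rw [div_le_div_iff₀ hm two_pos]; linarith
  have hb := Complex.norm_log_sub_logTaylor_le 2 (z := w / ((m : ℂ) + 1)) (by rw [hn]; linarith)
  have ht : logTaylor (2 + 1) (w / ((m : ℂ) + 1)) =
      w / (m + 1) - (w / (m + 1)) ^ 2 / 2 := by
    simp only [logTaylor, Finset.sum_range_succ, Finset.sum_range_zero]
    norm_num
    ring
  have he : barnesLogFactor w m = (m + 1) *
      (log (1 + w / (m + 1)) - logTaylor (2 + 1) (w / ((m : ℂ) + 1))) := by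
    rw [ht, barnesLogFactor]
    field_simp
    ring
  have hi : (1 - ‖w‖ / ((m : ℝ) + 1))⁻¹ ≤ 2 := by
    rw [inv_le_comm₀ (by linarith) two_pos]; linarith
  have hm1 : ‖(m : ℂ) + 1‖ = m + 1 := by
    rw [← Nat.cast_succ, Complex.norm_natCast, Nat.cast_succ]
  rw [he, norm_mul, hm1]
  rw [hn] at hb
  calc ((m : ℝ) + 1) * ‖log (1 + w / (m + 1)) - logTaylor (2 + 1) (w / ((m : ℂ) + 1))‖
      ≤ ((m : ℝ) + 1) * ((‖w‖ / (m + 1)) ^ 3 * 2 / 2) := by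
        refine mul_le_mul_of_nonneg_left (hb.trans ?_) hm.le
        have : (0 : ℝ) ≤ (‖w‖ / (m + 1)) ^ 3 := by positivity
        norm_num
        rw [div_le_iff₀ (by norm_num)]
        nlinarith
    _ = _ := by field_simp

lemma summable_barnesLogFactor (w : ℂ) : Summable (barnesLogFactor w) := by
  have h1 : Summable fun m : ℕ => ‖w‖ ^ 3 * (1 / ((m : ℝ) + 1) ^ 2) := by
    refine Summable.mul_left _ ?_
    exact_mod_cast (summable_nat_add_iff 1).2 (Real.summable_one_div_nat_pow.2 one_lt_two)
  refine Summable.of_norm_bounded_eventually_nat h1 ?_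
  filter_upwards [eventually_ge_atTop ⌈2 * ‖w‖⌉₊] with m hm
  refine norm_barnesLogFactor_le ?_
  have := Nat.ceil_le.1 hm
  linarith

/-- The factor of index `m + 1` in the Weierstrass product of `G (w + 1)`. -/
def barnesFactor (w : ℂ) (m : ℕ) : ℂ :=
  (1 + w / ((m : ℂ) + 1)) ^ (m + 1) * exp (-w + w ^ 2 / (2 * ((m : ℂ) + 1)))

lemma exp_barnesLogFactor {w : ℂ} (hw : ∀ m : ℕ, w ≠ -(m + 1)) (m : ℕ) :
    exp (barnesLogFactor w m) = barnesFactor w m := by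
  have hm' : (m : ℂ) + 1 ≠ 0 := Nat.cast_add_one_ne_zero m
  have h1 : 1 + w / ((m : ℂ) + 1) ≠ 0 := by
    intro h
    refine hw m ?_
    field_simp at h
    linear_combination h
  rw [barnesLogFactor, barnesFactor, exp_add, ← Nat.cast_succ, exp_nat_mul, Nat.cast_succ,
    exp_log h1]

lemma hasProd_barnesFactor {w : ℂ} (hw : ∀ m : ℕ, w ≠ -(m + 1)) :
    HasProd (barnesFactor w) (exp (∑' m, barnesLogFactor w m)) := by
  have := (summable_barnesLogFactor w).hasSum.cexp
  rwa [show cexp ∘ barnesLogFactor w = barnesFactor w from funext (exp_barnesLogFactor hw)] at this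

lemma barnesG_ne_zero {z : ℂ} (hz : ∀ m : ℕ, z ≠ -m) : barnesG z ≠ 0 := by
  have hw : ∀ m : ℕ, z - 1 ≠ -(m + 1) := fun m h => hz m (by linear_combination h)
  have h := (hasProd_barnesFactor hw).tprod_eq
  simp only [barnesFactor] at h
  rw [barnesG, h]
  have h2 : (2 * (Real.pi : ℂ)) ≠ 0 := by simp [Real.pi_ne_zero]
  refine mul_ne_zero (mul_ne_zero ?_ (exp_ne_zero _)) (exp_ne_zero _)
  simp [cpow_eq_zero_iff, h2]

/-- The quotient of the partial products at `w + 1` and `w` telescopes, since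
`1 + (w + 1) / k = (w + k + 1) / k`. -/
lemma prod_barnesFactor_add_one {w : ℂ} (hw : ∀ m : ℕ, w ≠ -(m + 1)) (N : ℕ) :
    ∏ m ∈ Finset.range N, barnesFactor (w + 1) m =
      (∏ m ∈ Finset.range N, barnesFactor w m) *
        ((N + 1 + w) ^ N / (∏ m ∈ Finset.range N, (w + 1 + m)) *
          exp (-N + (w + 1 / 2) * (harmonic N : ℚ))) := by
  induction N with
  | zero => simp
  | succ N ih =>
    have hN : (N : ℂ) + 1 ≠ 0 := Nat.cast_add_one_ne_zero N
    have h0 : ∀ m : ℕ, w + 1 + m ≠ 0 := fun m h => hw m (by linear_combination h)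
    have hp : ∏ m ∈ Finset.range N, (w + 1 + m) ≠ 0 := Finset.prod_ne_zero_iff.2 fun m _ => h0 m
    have hq := h0 N
    have e1 : exp (-((N + 1 : ℕ) : ℂ) + (w + 1 / 2) * (harmonic (N + 1) : ℚ)) =
        exp (-N + (w + 1 / 2) * (harmonic N : ℚ)) *
          exp (-1 + (w + 1 / 2) / (N + 1)) := by
      rw [← exp_add, harmonic_succ]
      congr 1
      push_cast
      field_simp
      ring
    have e2 : exp (-(w + 1) + (w + 1) ^ 2 / (2 * ((N : ℂ) + 1))) =
        exp (-w + w ^ 2 / (2 * ((N : ℂ) + 1))) * exp (-1 + (w + 1 / 2) / (N + 1)) := by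
      rw [← exp_add]
      congr 1
      field_simp
      ring
    have e3 : 1 + (w + 1) / ((N : ℂ) + 1) = (N + 1 + 1 + w) / (N + 1) := by field_simp; ring
    have e4 : 1 + w / ((N : ℂ) + 1) = (w + 1 + N) / (N + 1) := by field_simp; ring
    rw [Finset.prod_range_succ, ih, Finset.prod_range_succ, Finset.prod_range_succ, e1,
      barnesFactor, barnesFactor, e2, e3, e4, show (N : ℂ) + 1 + w = w + 1 + N by ring, div_pow,
      div_pow]
    push_cast
    field_simp
    ring

/-- The limit of the ratio of the partial products, from Euler's limit for `Γ`, Stirling's formula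
and the definition of Euler's constant. -/
lemma tendsto_barnesFactor_ratio {w : ℂ} (hw : ∀ m : ℕ, w ≠ -(m + 1)) :
    Tendsto (fun N : ℕ => (N + 1 + w) ^ N / (∏ m ∈ Finset.range N, (w + 1 + m)) *
      exp (-N + (w + 1 / 2) * (harmonic N : ℚ))) atTop
      (𝓝 (Gamma (w + 1) * exp (w + 1) * (1 / (((√2 : ℝ) : ℂ) * ((√Real.pi : ℝ) : ℂ))) *
        exp ((w + 1 / 2) * (Real.eulerMascheroniConstant : ℂ)))) := by
  have t1 := GammaSeq_tendsto_Gamma (w + 1)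
  have t2 := tendsto_one_add_div_pow_exp (w + 1)
  have t3 : Tendsto (fun N : ℕ => 1 + (w + 1) / (N : ℂ)) atTop (𝓝 1) := by
    simpa using (tendsto_const_div_atTop_nhds_zero_nat (w + 1)).const_add 1
  have t4 : Tendsto (fun N : ℕ => 1 / (((√2 : ℝ) : ℂ) * ((Stirling.stirlingSeq N : ℝ) : ℂ))) atTop
      (𝓝 (1 / (((√2 : ℝ) : ℂ) * ((√Real.pi : ℝ) : ℂ)))) := by
    have := (continuous_ofReal.tendsto _).comp Stirling.tendsto_stirlingSeq_sqrt_pi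
    refine tendsto_const_nhds.div (tendsto_const_nhds.mul this) ?_
    have h1 : √(2 : ℝ) ≠ 0 := by positivity
    have h2 : √Real.pi ≠ 0 := by positivity
    exact mul_ne_zero (ofReal_ne_zero.2 h1) (ofReal_ne_zero.2 h2)
  have t5 : Tendsto (fun N : ℕ => exp ((w + 1 / 2) * ((harmonic N - Real.log N : ℝ) : ℂ))) atTop
      (𝓝 (exp ((w + 1 / 2) * (Real.eulerMascheroniConstant : ℂ)))) :=
    ((continuous_ofReal.tendsto _).comp Real.tendsto_harmonic_sub_log).const_mul _ |>.cexp
  have t := ((t1.mul (t2.mul t3)).mul t4).mul t5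
  rw [mul_one] at t
  refine t.congr' ?_
  filter_upwards [eventually_ne_atTop 0] with N hN
  have hN' : (N : ℂ) ≠ 0 := Nat.cast_ne_zero.2 hN
  have hNpos : (0 : ℝ) < N := Nat.cast_pos.2 (Nat.pos_of_ne_zero hN)
  have h0 : ∀ m : ℕ, w + 1 + m ≠ 0 := fun m h => hw m (by linear_combination h)
  have hp : ∏ m ∈ Finset.range N, (w + 1 + m) ≠ 0 := Finset.prod_ne_zero_iff.2 fun m _ => h0 m
  have hq := h0 N
  have hf : (N.factorial : ℂ) ≠ 0 := Nat.cast_ne_zero.2 N.factorial_ne_zero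
  have hlog : exp (Real.log N : ℂ) = N := by
    rw [← ofReal_exp, Real.exp_log hNpos, ofReal_natCast]
  have hs2 : ((√2 : ℝ) : ℂ) ≠ 0 := ofReal_ne_zero.2 (by positivity)
  have hsqrt : ((√(N : ℝ) : ℝ) : ℂ) = exp ((Real.log N : ℂ) / 2) := by
    rw [Real.sqrt_eq_rpow, Real.rpow_def_of_pos hNpos, ofReal_exp]
    push_cast
    ring_nf
  have e1 : (1 : ℂ) / (((√2 : ℝ) : ℂ) * ((Stirling.stirlingSeq N : ℝ) : ℂ)) =
      N ^ N * exp (-N) * exp ((Real.log N : ℂ) / 2) / N.factorial := by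
    rw [Stirling.stirlingSeq, Real.sqrt_mul zero_le_two, ← hsqrt]
    push_cast
    rw [div_pow, ← exp_nat_mul, mul_one, exp_neg]
    have : ((√(N : ℝ) : ℝ) : ℂ) ≠ 0 := ofReal_ne_zero.2 (by positivity)
    have := exp_ne_zero (N : ℂ)
    field_simp
  have e2 : (N : ℂ) ^ (w + 1) = exp ((w + 1) * (Real.log N : ℂ)) := by
    rw [cpow_def_of_ne_zero hN', ← ofReal_natCast, ← ofReal_log hNpos.le, mul_comm]
  have e3 : exp (-N + (w + 1 / 2) * (harmonic N : ℚ)) =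
      exp (-N) * exp ((w + 1 / 2) * ((harmonic N - Real.log N : ℝ) : ℂ)) *
        (exp ((w + 1) * (Real.log N : ℂ)) * exp ((Real.log N : ℂ) / 2) /
          exp (Real.log N : ℂ)) := by
    rw [← exp_add, ← exp_add, ← exp_sub, ← exp_add]
    congr 1
    push_cast
    ring
  have e4 : 1 + (w + 1) / (N : ℂ) = (w + 1 + N) / N := by field_simp; ring
  rw [e1, e3, hlog, e4, GammaSeq, e2, Finset.prod_range_succ, show (N : ℂ) + 1 + w = w + 1 + N by ring,
    div_pow]
  have := exp_ne_zero ((w + 1) * (Real.log N : ℂ))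
  field_simp

lemma barnesG_add_one {z : ℂ} (hz : ∀ m : ℕ, z ≠ -m) :
    barnesG (z + 1) = Gamma z * barnesG z := by
  obtain ⟨w, rfl⟩ : ∃ w, z = w + 1 := ⟨z - 1, by ring⟩
  have hw : ∀ m : ℕ, w ≠ -(m + 1) := fun m h => hz m (by linear_combination h)
  have hw' : ∀ m : ℕ, w + 1 ≠ -(m + 1) := fun m h => hz (m + 1) (by push_cast; exact h)
  have h1 := (hasProd_barnesFactor hw).multipliable.hasProd
  have h2 := (hasProd_barnesFactor hw').multipliable.hasProd
  have h3 := tendsto_nhds_unique h2.tendsto_prod_nat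
    ((h1.tendsto_prod_nat.mul (tendsto_barnesFactor_ratio hw)).congr
      fun N => (prod_barnesFactor_add_one hw N).symm)
  simp only [barnesFactor] at h3
  rw [barnesG, barnesG, add_sub_cancel_right, add_sub_cancel_right, h3]
  have hpi : (2 * (Real.pi : ℂ)) ≠ 0 := by simp [Real.pi_ne_zero]
  have h4 : (2 * (Real.pi : ℂ)) ^ ((w + 1) / 2) =
      (2 * (Real.pi : ℂ)) ^ (w / 2) * (((√2 : ℝ) : ℂ) * ((√Real.pi : ℝ) : ℂ)) := by
    rw [add_div, cpow_add _ _ hpi]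
    congr 1
    rw [← ofReal_mul, ← Real.sqrt_mul zero_le_two, Real.sqrt_eq_rpow,
      ofReal_cpow (by positivity)]
    push_cast
    rfl
  have h5 : exp (-((w + 1) * (w + 1 + 1) +
        (Real.eulerMascheroniConstant : ℂ) * (w + 1) ^ 2) / 2) * (exp (w + 1) *
        exp ((w + 1 / 2) * (Real.eulerMascheroniConstant : ℂ))) =
      exp (-(w * (w + 1) + (Real.eulerMascheroniConstant : ℂ) * w ^ 2) / 2) := by
    rw [← exp_add, ← exp_add]
    congr 1
    ring
  have hs : (((√2 : ℝ) : ℂ) * ((√Real.pi : ℝ) : ℂ)) ≠ 0 :=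
    mul_ne_zero (ofReal_ne_zero.2 (by positivity)) (ofReal_ne_zero.2 (by positivity))
  rw [h4, ← h5]
  field_simp

end

/-! ### Values of the Barnes `G`-function at real arguments -/

lemma barnesG_one : barnesG 1 = 1 := by
  simp [barnesG]

lemma barnesG_ofReal_add_one {x : ℝ} (hx : ∀ m : ℕ, x ≠ -m) :
    barnesG ((x : ℂ) + 1) = (Real.Gamma x : ℂ) * barnesG x := by
  rw [barnesG_add_one fun m h => hx m (by exact_mod_cast h), Complex.Gamma_ofReal]

lemma barnesG_ofReal_ne_zero {x : ℝ} (hx : ∀ m : ℕ, x ≠ -m) : barnesG (x : ℂ) ≠ 0 :=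
  barnesG_ne_zero fun m h => hx m (by exact_mod_cast h)

lemma ne_neg_natCast_of_pos {x : ℝ} (hx : 0 < x) (m : ℕ) : x ≠ -m := by
  have : (0 : ℝ) ≤ m := m.cast_nonneg
  intro h
  linarith

lemma ne_neg_natCast_of_neg_one_lt {x : ℝ} (hx : -1 < x) (h0 : x ≠ 0) (m : ℕ) : x ≠ -m := by
  rcases m with _ | m
  · simpa using h0
  · intro h
    have : (0 : ℝ) ≤ m := m.cast_nonneg
    push_cast at h
    linarith

/-! ### The determinant in closed form -/

section
variable {α β : ℝ}

/-- For `n = 0` the closed form collapses to `1` by Legendre's duplication formula at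
`(α + β + 1) / 2`. -/
lemma jacobiHankelDet_zero (hα : -1 < α) (hβ : -1 < β) (hαβ : α + β ≠ -1) :
    jacobiHankelDet α β 0 = 1 := by
  have hs : α + β + 1 ≠ 0 := fun h => hαβ (by linarith)
  have n1 : ∀ m : ℕ, (α + β + 1) / 2 ≠ -(m : ℝ) :=
    ne_neg_natCast_of_neg_one_lt (by linarith) (by simpa using hs)
  have n2 : ∀ m : ℕ, (α + β + 2) / 2 ≠ -(m : ℝ) := ne_neg_natCast_of_pos (by linarith)
  have n3 : ∀ m : ℕ, α + β + 1 ≠ -(m : ℝ) := ne_neg_natCast_of_neg_one_lt (by linarith) hs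
  have n4 : ∀ m : ℕ, α + 1 ≠ -(m : ℝ) := ne_neg_natCast_of_pos (by linarith)
  have n5 : ∀ m : ℕ, β + 1 ≠ -(m : ℝ) := ne_neg_natCast_of_pos (by linarith)
  have e1 := barnesG_ofReal_add_one n1
  have e2 := barnesG_ofReal_add_one n2
  have e3 := barnesG_ofReal_add_one n3
  have e4 := barnesG_ofReal_add_one n4
  have e5 := barnesG_ofReal_add_one n5
  have e6 := barnesG_add_one (z := 1) (fun m h => by
    have : (1 : ℝ) = -m := by exact_mod_cast h
    exact ne_neg_natCast_of_pos one_pos m this)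
  rw [Complex.Gamma_one, barnesG_one, mul_one] at e6
  have z1 := barnesG_ofReal_ne_zero n1
  have z2 := barnesG_ofReal_ne_zero n2
  have z3 := barnesG_ofReal_ne_zero n3
  have z4 := barnesG_ofReal_ne_zero n4
  have z5 := barnesG_ofReal_ne_zero n5
  have g1 := Real.Gamma_ne_zero n1
  have g2 := Real.Gamma_ne_zero n2
  have g3 := Real.Gamma_ne_zero n3
  have g4 := Real.Gamma_ne_zero n4
  have g5 := Real.Gamma_ne_zero n5
  -- after the functional equation of `G`, Legendre's duplication formula remains
  have hdup := Real.Gamma_mul_Gamma_add_half ((α + β + 1) / 2)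
  rw [show (α + β + 1) / 2 + 1 / 2 = (α + β + 2) / 2 by ring, mul_div_cancel₀ _ (two_ne_zero' ℝ)]
    at hdup
  have hreal : Real.Gamma (α + β + 2) * (2 : ℝ) ^ (-(2 * α + 2 * β + ((0 : ℕ) : ℝ) + 1)) *
      Real.pi / (Real.Gamma (α + 1) * Real.Gamma (β + 1)) *
      (1 / (Real.Gamma ((α + β + 1) / 2) * Real.Gamma ((α + β + 2) / 2)) ^ 2) *
      (Real.Gamma (α + β + 1) * Real.Gamma (α + 1) * Real.Gamma (β + 1) /
        ((α + β + 1) / 2)) = 1 := by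
    have h2 : (2 : ℝ) ^ (-(2 * α + 2 * β + ((0 : ℕ) : ℝ) + 1)) =
        ((2 : ℝ) ^ (1 - (α + β + 1))) ^ 2 / 2 := by
      rw [← Real.rpow_natCast, ← Real.rpow_mul zero_le_two, ← Real.rpow_sub_one two_ne_zero]
      congr 1
      push_cast
      ring
    have h3 : Real.Gamma (α + β + 2) = (α + β + 1) * Real.Gamma (α + β + 1) := by
      rw [← Real.Gamma_add_one hs]; ring_nf
    have h4 : (2 : ℝ) ^ (1 - (α + β + 1)) ≠ 0 := by positivity
    have h5 : √Real.pi ^ 2 = Real.pi := Real.sq_sqrt Real.pi_pos.le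
    have h6 := Real.pi_ne_zero
    rw [hdup, h2, h3, mul_pow, mul_pow, h5]
    field_simp
  have hsf : shiftedFactorial ((α + β + 1) / 2) (0 + 1) = (α + β + 1) / 2 := by
    simp [shiftedFactorial_succ]
  rw [jacobiHankelDet, hsf]
  push_cast at e1 e2 e3 e4 e5 z1 z2 z3 z4 z5 hreal ⊢
  rw [show (0 : ℂ) + 2 = 1 + 1 by norm_num, e6,
    show ((α : ℂ) + β + 3) / 2 + 0 = (α + β + 1) / 2 + 1 by ring, e1,
    show ((α : ℂ) + β + 4) / 2 + 0 = (α + β + 2) / 2 + 1 by ring, e2,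
    show ((α : ℂ) + β + 0 + 2) = α + β + 1 + 1 by ring, e3,
    show ((α : ℂ) + 0 + 2) = α + 1 + 1 by ring, e4,
    show ((β : ℂ) + 0 + 2) = β + 1 + 1 by ring, e5]
  have hreal' := congrArg (fun x : ℝ => (x : ℂ)) hreal
  push_cast at hreal'
  refine Eq.trans ?_ hreal'
  have hs' : (α : ℂ) + β + 1 ≠ 0 := by exact_mod_cast hs
  replace g1 : ((Real.Gamma ((α + β + 1) / 2) : ℝ) : ℂ) ≠ 0 := Complex.ofReal_ne_zero.2 g1
  replace g2 : ((Real.Gamma ((α + β + 2) / 2) : ℝ) : ℂ) ≠ 0 := Complex.ofReal_ne_zero.2 g2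
  replace g4 : ((Real.Gamma (α + 1) : ℝ) : ℂ) ≠ 0 := Complex.ofReal_ne_zero.2 g4
  replace g5 : ((Real.Gamma (β + 1) : ℝ) : ℂ) ≠ 0 := Complex.ofReal_ne_zero.2 g5
  field_simp

/-- The squared norm of the monic orthogonal polynomial, written in the `Γ`-values that the
functional equation of `G` produces in the closed form of the determinant. -/
lemma jacobiNorm_div_jacobiTaylorCoeff_sq (hα : -1 < α) (hβ : -1 < β) (n : ℕ) :
    jacobiNorm α β (n + 1) / jacobiTaylorCoeff α β (n + 1) (n + 1) ^ 2 =
      Real.Gamma (α + β + 2) * (2 : ℝ) ^ (-(2 * α + 2 * β + 1)) * Real.pi /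
        (Real.Gamma (α + 1) * Real.Gamma (β + 1)) * (((2 : ℝ) ^ (n + 1)) ^ 2)⁻¹ *
      (Real.Gamma (n + 2) * Real.Gamma (α + β + n + 2) * Real.Gamma (α + n + 2) *
        Real.Gamma (β + n + 2) /
        ((Real.Gamma ((α + β + 3) / 2 + n) * Real.Gamma ((α + β + 4) / 2 + n)) ^ 2 *
          ((α + β + 1) / 2 + (n + 1 : ℕ)))) := by
  have hn : (0 : ℝ) ≤ n := n.cast_nonneg
  have p0 : 0 < α + β + 2 := by linarith
  have pα : 0 < α + 1 := by linarith
  have pβ : 0 < β + 1 := by linarith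
  have pm : 0 < α + β + n + 2 := by linarith
  have p2 : 0 < α + β + 2 * n + 3 := by linarith
  -- all shifted factorials as quotients of `Γ`-values
  have f1 := shiftedFactorial_mul_Gamma pα (n + 1)
  have f2 := shiftedFactorial_mul_Gamma pβ (n + 1)
  have f3 := shiftedFactorial_mul_Gamma pm (n + 1)
  have f4 := shiftedFactorial_mul_Gamma p0 (2 * (n + 1))
  have f5 := Real.Gamma_nat_eq_factorial (n + 1)
  have f6 := Real.Gamma_add_one p2.ne'
  have hdup := Real.Gamma_mul_Gamma_add_half ((α + β + 3) / 2 + n)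
  push_cast at f1 f2 f3 f4 f5
  rw [show α + 1 + ((n : ℝ) + 1) = α + n + 2 by ring] at f1
  rw [show β + 1 + ((n : ℝ) + 1) = β + n + 2 by ring] at f2
  rw [show α + β + n + 2 + ((n : ℝ) + 1) = α + β + 2 * n + 3 by ring] at f3
  rw [show α + β + 2 + 2 * ((n : ℝ) + 1) = α + β + 2 * n + 3 + 1 by ring, f6] at f4
  rw [show (n : ℝ) + 1 + 1 = n + 2 by ring] at f5
  rw [show (α + β + 3) / 2 + (n : ℝ) + 1 / 2 = (α + β + 4) / 2 + n by ring,
    show 2 * ((α + β + 3) / 2 + (n : ℝ)) = α + β + 2 * n + 3 by ring] at hdup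
  have h2 : (2 : ℝ) ^ (1 - (α + β + 2 * n + 3)) =
      2 ^ (-(α + β)) * (((2 : ℝ) ^ (n + 1)) ^ 2)⁻¹ := by
    rw [← pow_mul, ← Real.rpow_natCast, ← Real.rpow_neg zero_le_two, ← Real.rpow_add two_pos]
    congr 1
    push_cast
    ring
  have h3 : (2 : ℝ) ^ (-(2 * α + 2 * β + 1)) = ((2 : ℝ) ^ (-(α + β))) ^ 2 / 2 := by
    rw [← Real.rpow_natCast, ← Real.rpow_mul zero_le_two, ← Real.rpow_sub_one two_ne_zero]
    congr 1
    push_cast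
    ring
  have h5 : √Real.pi ^ 2 = Real.pi := Real.sq_sqrt Real.pi_pos.le
  rw [hdup, h2, h3, mul_pow, mul_pow, h5, f5, ← f1, ← f2, jacobiNorm, jacobiTaylorCoeff_self]
  push_cast
  rw [show (n : ℝ) + 1 + α + β + 1 = α + β + n + 2 by ring,
    show (α + β + 1) / 2 + ((n : ℝ) + 1) = (α + β + 2 * n + 3) / 2 by ring]
  have g1 := (Real.Gamma_pos_of_pos pα).ne'
  have g2 := (Real.Gamma_pos_of_pos pβ).ne'
  have g3 := (Real.Gamma_pos_of_pos pm).ne'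
  have g4 := (Real.Gamma_pos_of_pos p0).ne'
  have g5 := (Real.Gamma_pos_of_pos p2).ne'
  have s1 := (shiftedFactorial_pos pm (n + 1)).ne'
  have s2 := (shiftedFactorial_pos p0 (2 * (n + 1))).ne'
  have hf : ((n + 1).factorial : ℝ) ≠ 0 := by positivity
  have hpi := Real.pi_ne_zero
  have hr : (2 : ℝ) ^ (-(α + β)) ≠ 0 := by positivity
  have hp : (2 : ℝ) ^ (n + 1) ≠ 0 := by positivity
  rw [← f3] at f4 g5 ⊢
  have hneg : ((-2 : ℝ) ^ (n + 1)) ^ 2 = ((2 : ℝ) ^ (n + 1)) ^ 2 := by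
    rw [← pow_mul, ← pow_mul, mul_comm, pow_mul, pow_mul]; norm_num
  rw [div_pow, mul_pow, hneg]
  have p2' := p2.ne'
  generalize α + β + 2 * (n : ℝ) + 3 = T at f4 p2' ⊢
  field_simp
  linear_combination
    (-(shiftedFactorial (α + 1) (n + 1) * shiftedFactorial (β + 1) (n + 1))) * f4

lemma jacobiHankelDet_succ (hα : -1 < α) (hβ : -1 < β) (n : ℕ) :
    jacobiHankelDet α β (n + 1) = jacobiHankelDet α β n *
      ((jacobiNorm α β (n + 1) / jacobiTaylorCoeff α β (n + 1) (n + 1) ^ 2 : ℝ) : ℂ) := by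
  have hn : (0 : ℝ) ≤ n := n.cast_nonneg
  have e1 := barnesG_ofReal_add_one (ne_neg_natCast_of_pos (x := n + 2) (by linarith))
  have e2 := barnesG_ofReal_add_one
    (ne_neg_natCast_of_pos (x := (α + β + 3) / 2 + n) (by linarith))
  have e3 := barnesG_ofReal_add_one
    (ne_neg_natCast_of_pos (x := (α + β + 4) / 2 + n) (by linarith))
  have e4 := barnesG_ofReal_add_one (ne_neg_natCast_of_pos (x := α + β + n + 2) (by linarith))
  have e5 := barnesG_ofReal_add_one (ne_neg_natCast_of_pos (x := α + n + 2) (by linarith))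
  have e6 := barnesG_ofReal_add_one (ne_neg_natCast_of_pos (x := β + n + 2) (by linarith))
  have hpow : ∀ k : ℕ, (2 : ℝ) ^ (-(2 * α + 2 * β + (k : ℝ) + 1)) =
      (2 : ℝ) ^ (-(2 * α + 2 * β + 1)) * ((2 : ℝ) ^ k)⁻¹ := fun k => by
    rw [← Real.rpow_natCast, ← Real.rpow_neg zero_le_two, ← Real.rpow_add two_pos]
    congr 1
    ring
  have hassoc : ∀ k : ℕ,
      Real.Gamma (α + β + 2) * ((2 : ℝ) ^ (-(2 * α + 2 * β + 1)) * ((2 : ℝ) ^ k)⁻¹) *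
        Real.pi / (Real.Gamma (α + 1) * Real.Gamma (β + 1)) =
      Real.Gamma (α + β + 2) * (2 : ℝ) ^ (-(2 * α + 2 * β + 1)) *
        Real.pi / (Real.Gamma (α + 1) * Real.Gamma (β + 1)) * ((2 : ℝ) ^ k)⁻¹ := fun k => by ring
  -- `(n + 1) (n + 2) = n (n + 1) + 2 (n + 1)` for the exponents of `2`
  have hbase : ∀ c : ℝ, (c * ((2 : ℝ) ^ (n + 1))⁻¹) ^ (n + 1 + 1) =
      (c * ((2 : ℝ) ^ n)⁻¹) ^ (n + 1) * (c * (((2 : ℝ) ^ (n + 1)) ^ 2)⁻¹) := fun c => by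
    simp only [mul_pow, ← pow_mul, ← inv_pow]
    rw [show (n + 1) * (n + 1 + 1) = n * (n + 1) + (n + 1) * 2 by ring, pow_add, pow_succ c]
    ring
  rw [jacobiNorm_div_jacobiTaylorCoeff_sq hα hβ, jacobiHankelDet, jacobiHankelDet, hpow, hpow,
    hassoc, hassoc, hbase, shiftedFactorial_succ _ (n + 1)]
  generalize Real.Gamma (α + β + 2) * (2 : ℝ) ^ (-(2 * α + 2 * β + 1)) *
      Real.pi / (Real.Gamma (α + 1) * Real.Gamma (β + 1)) = c
  push_cast at e1 e2 e3 e4 e5 e6 ⊢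
  rw [show (n : ℂ) + 1 + 2 = n + 2 + 1 by ring, e1,
    show ((α : ℂ) + β + 3) / 2 + (n + 1) = (α + β + 3) / 2 + n + 1 by ring, e2,
    show ((α : ℂ) + β + 4) / 2 + (n + 1) = (α + β + 4) / 2 + n + 1 by ring, e3,
    show (α : ℂ) + β + (n + 1) + 2 = α + β + n + 2 + 1 by ring, e4,
    show (α : ℂ) + (n + 1) + 2 = α + n + 2 + 1 by ring, e5,
    show (β : ℂ) + (n + 1) + 2 = β + n + 2 + 1 by ring, e6]
  simp only [div_eq_mul_inv, mul_inv, mul_pow]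
  ring

lemma det_jacobiHankel_eq (hα : -1 < α) (hβ : -1 < β) (hαβ : α + β ≠ -1) (n : ℕ) :
    ((jacobiHankel α β n).det : ℂ) = jacobiHankelDet α β n := by
  induction n with
  | zero => rw [jacobiHankelDet_zero hα hβ hαβ, det_jacobiHankel_zero, Complex.ofReal_one]
  | succ n ih =>
    rw [jacobiHankelDet_succ hα hβ, ← ih, det_jacobiHankel_succ hα hβ, Complex.ofReal_mul]

/-! ### Continuity in the parameters -/

lemma continuous_shiftedFactorial (n : ℕ) : Continuous fun a : ℝ => shiftedFactorial a n :=
  (ascPochhammer ℝ n).continuous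

lemma continuousAt_jacobiHankel (hα : -1 < α) (hβ : -1 < β) (n : ℕ) :
    ContinuousAt (fun q : ℝ × ℝ => jacobiHankel q.1 q.2 n) (α, β) := by
  refine continuousAt_pi.2 fun i => continuousAt_pi.2 fun j => ?_
  have h : ∀ q : ℝ × ℝ, jacobiHankel q.1 q.2 n i j =
      ∑ m ∈ Finset.range ((i : ℕ) + j + 1), (-1) ^ m * ((((i : ℕ) + j).choose m : ℕ) : ℝ) *
        (shiftedFactorial (q.2 + 1) m / shiftedFactorial (q.1 + q.2 + 2) m) * 2 ^ m := fun q => by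
    rw [← ordinaryHypergeometric_neg_natCast, jacobiHankel, Matrix.of_apply]
    push_cast
    rw [neg_add']
  simp only [h]
  refine tendsto_finsetSum _ fun m _ => ?_
  have h1 : ContinuousAt (fun q : ℝ × ℝ => shiftedFactorial (q.2 + 1) m) (α, β) :=
    ((continuous_shiftedFactorial m).comp (by fun_prop)).continuousAt
  have h2 : ContinuousAt (fun q : ℝ × ℝ => shiftedFactorial (q.1 + q.2 + 2) m) (α, β) :=
    ((continuous_shiftedFactorial m).comp (by fun_prop)).continuousAt
  have h3 : shiftedFactorial (α + β + 2) m ≠ 0 := (shiftedFactorial_pos (by linarith) m).ne'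
  exact ((h1.div h2 h3).const_mul _).mul_const _

lemma eventually_neg_one_lt (hα : -1 < α) (hβ : -1 < β) :
    ∀ᶠ q : ℝ × ℝ in 𝓝[{q : ℝ × ℝ | q.1 + q.2 ≠ -1}] (α, β),
      -1 < q.1 ∧ -1 < q.2 ∧ q.1 + q.2 ≠ -1 := by
  filter_upwards [self_mem_nhdsWithin,
    mem_nhdsWithin_of_mem_nhds
      ((continuous_fst.tendsto ((α, β) : ℝ × ℝ)).eventually_const_lt hα),
    mem_nhdsWithin_of_mem_nhds
      ((continuous_snd.tendsto ((α, β) : ℝ × ℝ)).eventually_const_lt hβ)]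
    with q h1 h2 h3
  exact ⟨h2, h3, h1⟩

end

end

theorem mainTheorem4 (α β : ℝ) (hα : -1 < α) (hβ : -1 < β) (n : ℕ) :
    -- the entries are the normalized moments of the Jacobi weight, up to alternating signs
    (0 < jacobiMoment α β 0 ∧
      ∀ i j : Fin (n + 1), jacobiHankel α β n i j =
        (-1 : ℝ) ^ ((i : ℕ) + (j : ℕ)) *
          (jacobiMoment α β ((i : ℕ) + (j : ℕ)) / jacobiMoment α β 0)) ∧
    IsUnit (jacobiHankel α β n) ∧
    -- the closed forms
    (α + β ≠ -1 →
      ((jacobiHankel α β n).det : ℂ) = jacobiHankelDet α β n ∧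
      ∀ i j : Fin (n + 1), (jacobiHankel α β n)⁻¹ i j = jacobiHankelInv α β n i j) ∧
    -- on the line `α + β = -1` the closed forms have removable singularities
    (α + β = -1 →
      Tendsto (fun q : ℝ × ℝ => jacobiHankelDet q.1 q.2 n)
        (𝓝[{q : ℝ × ℝ | q.1 + q.2 ≠ -1}] (α, β)) (𝓝 ((jacobiHankel α β n).det : ℂ)) ∧
      ∀ i j : Fin (n + 1),
        Tendsto (fun q : ℝ × ℝ => jacobiHankelInv q.1 q.2 n i j)
          (𝓝[{q : ℝ × ℝ | q.1 + q.2 ≠ -1}] (α, β)) (𝓝 ((jacobiHankel α β n)⁻¹ i j))) := by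
  have hdet := det_jacobiHankel_ne_zero hα hβ n
  have hcont := continuousAt_jacobiHankel hα hβ n
  have hcdet : ContinuousAt (fun q : ℝ × ℝ => (jacobiHankel q.1 q.2 n).det) (α, β) :=
    (continuous_id.matrix_det.continuousAt).comp hcont
  refine ⟨⟨jacobiMoment_zero_pos hα hβ, jacobiHankel_eq_jacobiMoment_div hα hβ n⟩,
    (Matrix.isUnit_iff_isUnit_det _).2 hdet.isUnit,
    fun h => ⟨det_jacobiHankel_eq hα hβ h n, inv_jacobiHankel_apply hα hβ h n⟩,
    fun _ => ⟨?_, fun i j => ?_⟩⟩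
  -- off the line the closed forms agree with quantities that are continuous across it
  · have h := (Complex.continuous_ofReal.continuousAt.comp hcdet).tendsto.mono_left
      (nhdsWithin_le_nhds (s := {q : ℝ × ℝ | q.1 + q.2 ≠ -1}))
    refine h.congr' ?_
    filter_upwards [eventually_neg_one_lt hα hβ] with q hq
    exact det_jacobiHankel_eq hq.1 hq.2.1 hq.2.2 n
  · have hinv : ContinuousAt (fun q : ℝ × ℝ => (jacobiHankel q.1 q.2 n)⁻¹ i j) (α, β) := by
      simp only [Matrix.inv_def, Ring.inverse_eq_inv', Matrix.smul_apply, smul_eq_mul]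
      refine (hcdet.inv₀ hdet).mul ?_
      exact ((continuous_id.matrix_adjugate.matrix_elem i j).continuousAt).comp hcont
    refine (hinv.tendsto.mono_left nhdsWithin_le_nhds).congr' ?_
    filter_upwards [eventually_neg_one_lt hα hβ] with q hq
    exact inv_jacobiHankel_apply hq.1 hq.2.1 hq.2.2 n i j
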